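/- A probabilistic finite state transducer (pfst) $T$ consists of a finite set $Q$ of states, finite input and output alphabets $\Sigma_1,\Sigma_2$, an initial state $q_0\in Q$, disjoint sets $Q_{\rm acc},Q_{\rm rej}\subseteq Q$ of accepting and rejecting (halting) states, and, for each $a\in\Sigma_1\cup\{\ddag,\$\}$ (where $\ddag,\$\notin\Sigma_1$ are an initial and an end marker), a stochastic matrix $V_a=((V_a)_{qp})_{q,p\in Q}$ and a function $f_a:Q\to\Sigma_2^*$; the matrix $V_\$$ leads from non-halting states to halting states only. On input $v\in\Sigma_1^*$ the transducer starts in $q_0$ with an empty output tape and reads $\ddag v\$$ from left to right. Reading $a$ in state $q$, it appends $f_a(q)$ to the output tape and moves to state $p$ with probability $(V_a)_{qp}$; whenever the state reached after such a step is halting, the computation stops, accepting or rejecting accordingly. Let $T(w|v)$ be the probability that $T$ accepts $v$ with the word $w\in\Sigma_2^*$ on the output tape. Let $\mathcal R\subseteq\Sigma_1^*\times\Sigma_2^*$. For $\alpha>1/2$, $T$ computes $\mathcal R$ with probability $\alpha$ if for all $v\in\Sigma_1^*$, $w\in\Sigma_2^*$: $T(w|v)\ge\alpha$ if $(v,w)\in\mathcal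 R$, and $T(w|v)\le 1-\alpha$ if $(v,w)\notin\mathcal R$. For $0<\alpha<1$, $T$ computes $\mathcal R$ with isolated cutpoint $\alpha$ if there is $\varepsilon>0$ such that for all $v\in\Sigma_1^*$, $w\in\Sigma_2^*$: $T(w|v)\ge\alpha+\varepsilon$ if $(v,w)\in\mathcal R$, and $T(w|v)\le\alpha-\varepsilon$ if $(v,w)\notin\mathcal R$. **Theorem.** Let $\Sigma_1$ contain the distinct letters $0,1,2$ and let $\Sigma_2$ contain the letter $3$. The relation $$\mathcal R_3=\{(0^m1^n2^k,3^m):\ m,n,k\ge 0,\ n\ne k,\ (m=k\text{ or }m=n)\}$$ cannot be computed by any pfst with probability bounded away from $1/2$, i.e. there are no pfst $T$ and $\alpha>1/2$ such that $T$ computes $\mathcal R_3$ with probability $\alpha$. In fact, it cannot even be computed by a pfst with an isolated cutpoint, i.e. there are no pfst $T$ and $\alpha\in(0,1)$ such that $T$ computes $\mathcal R_3$ with isolated cutpoint $\alpha$. -/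

import Mathlib

/-- The symbols a transducer with input alphabet `A` actually reads: the letters of `A`, together
with the initial marker `‡` and the end marker `$`. -/
inductive TapeSymbol (A : Type*) where
  | start : TapeSymbol A
  | letter (a : A) : TapeSymbol A
  | finish : TapeSymbol A

/-- A probabilistic finite state transducer with (finite) state set `Q`, input alphabet `A` and
output alphabet `B`. In state `q`, reading the symbol `a`, it prints the word `f a q` and moves to
state `p` with probability `V a q p`. The states in `acc` and `rej` are the halting ones. -/
structure PFST (Q A B : Type*) [Fintype Q] [DecidableEq Q] [Fintype A] [Fintype B] where
  /-- the transition matrices, including those of the two markers -/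
  V : TapeSymbol A → Matrix Q Q ℝ
  /-- the output words, including those printed while reading the two markers -/
  f : TapeSymbol A → Q → List B
  /-- the initial state -/
  q₀ : Q
  /-- the accepting states -/
  acc : Finset Q
  /-- the rejecting states -/
  rej : Finset Q
  disjoint_acc_rej : Disjoint acc rej
  stochastic : ∀ a, V a ∈ Matrix.rowStochastic ℝ Q
  /-- The end marker leads from non-halting states to halting states only. (The rows of `V` at
  halting states are irrelevant here, because the computation has stopped there.) -/
  finish_halts : ∀ q ∉ acc ∪ rej, ∀ p ∉ acc ∪ rej, V TapeSymbol.finish q p = 0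

/-- A total state: the weights of the running configurations (state, tape content), the weights of
the outputs that have been accepted, and the weight of rejection. All total states which occur in
a computation are finitely supported. -/
structure TotalState (Q B : Type*) where
  running : (Q × List B) →₀ ℝ
  accepted : List B →₀ ℝ
  rejected : ℝ

namespace PFST

variable {Q A B : Type*} [Fintype Q] [DecidableEq Q] [Fintype A] [Fintype B]

/-- The non-halting states. -/
def non (T : PFST Q A B) : Finset Q := (T.acc ∪ T.rej)ᶜ

/-- The total state at the beginning: state `q₀` and empty output tape, with weight one. -/
noncomputable def initial (T : PFST Q A B) : TotalState Q B where
  running := Finsupp.single (T.q₀, []) 1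
  accepted := 0
  rejected := 0

/-- The (linear) transformation of the total state when the symbol `a` is read: a running
configuration `(q, w)` of weight `c` passes on the weight `c * V a q p` to the configuration
`(p, w ++ f a q)` if `p` is non-halting, to the accepted output `w ++ f a q` if `p` is accepting,
and to rejection if `p` is rejecting. -/
noncomputable def step (T : PFST Q A B) (a : TapeSymbol A) (S : TotalState Q B) :
    TotalState Q B where
  running := S.running.sum fun x c =>
    ∑ p ∈ T.non, Finsupp.single (p, x.2 ++ T.f a x.1) (c * T.V a x.1 p)
  accepted := S.accepted + S.running.sum fun x c =>
    Finsupp.single (x.2 ++ T.f a x.1) (c * ∑ p ∈ T.acc, T.V a x.1 p)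
  rejected := S.rejected + S.running.sum fun x c => c * ∑ p ∈ T.rej, T.V a x.1 p

/-- The total state after the word `‡ v $` has been read, from left to right. -/
noncomputable def run (T : PFST Q A B) (v : List A) : TotalState Q B :=
  (TapeSymbol.start :: (v.map TapeSymbol.letter ++ [TapeSymbol.finish])).foldl
    (fun S a => T.step a S) T.initial

/-- `T.prob w v` is the probability `T(w|v)` that `T` accepts the input `v` after having produced
the output `w`. -/
noncomputable def prob (T : PFST Q A B) (w : List B) (v : List A) : ℝ :=
  (T.run v).accepted w

/-- `T` computes the relation `R` with probability `α` (where `α > 1/2`). -/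
def ComputesWithProbability (T : PFST Q A B) (R : Set (List A × List B)) (α : ℝ) : Prop :=
  1 / 2 < α ∧ ∀ (v : List A) (w : List B),
    ((v, w) ∈ R → α ≤ T.prob w v) ∧ ((v, w) ∉ R → T.prob w v ≤ 1 - α)

/-- `T` computes the relation `R` with isolated cutpoint `α` (where `0 < α < 1`). -/
def ComputesWithIsolatedCutpoint (T : PFST Q A B) (R : Set (List A × List B)) (α : ℝ) : Prop :=
  0 < α ∧ α < 1 ∧ ∃ ε : ℝ, 0 < ε ∧ ∀ (v : List A) (w : List B),
    ((v, w) ∈ R → α + ε ≤ T.prob w v) ∧ ((v, w) ∉ R → T.prob w v ≤ α - ε)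

end PFST

/-- The relation `{(0^m 1^n 2^k, 3^m) : n ≠ k ∧ (m = k ∨ m = n)}`, where the input letters
`0, 1, 2` are `a₀, a₁, a₂` and the output letter `3` is `b₃`. -/
def relationR3 {A B : Type*} (a₀ a₁ a₂ : A) (b₃ : B) : Set (List A × List B) :=
  {x | ∃ m n k : ℕ, n ≠ k ∧ (m = k ∨ m = n) ∧
    x = (List.replicate m a₀ ++ List.replicate n a₁ ++ List.replicate k a₂,
      List.replicate m b₃)}

/-! Record the output `3^n` as `X^n`. Reading a symbol becomes a matrix over `ℝ⟦X⟧`, and the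
acceptance probability of `(0^m 1^n 2^k, 3^m)` becomes the `X^m` coefficient of an entry of `L m *
A^n * B^k * D` (`prob_replicate`), all factors having row mass at most 1. Let `F` and `E` be
coefficientwise limits of `A^n` and `B^n` along an ultrafilter. Letting `n` or `k` run off gives the
coefficients of `A^m * E` and `F * B^m` at least `α + ε`, and that of `F * E` at most `α - ε`. In
such a limit mass can escape to infinite degree but cannot appear, so `A^m` dominates `F` and `B^m`
dominates `E` up to a total mass tending to 0 (`exists_deficit_rowMassLE`). Hence `(A^m - F) * (B^m
- E)` is nonnegative up to a small error, even between the `m`-dependent factor `L m` and `D`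
(`neg_le_coeff_mul_sub_mul_sub`). Expanding it shows that `A^m * B^m` has coefficient at least about
`α + 3ε`, although `n = k = m` must be rejected (`not_separated`). -/

open PowerSeries Filter Topology
open scoped PowerSeries.WithPiTopology Matrix

/-! ### Power series with nonnegative coefficients. -/

namespace PowerSeries

/-- The power series all of whose coefficients are nonnegative. -/
def nonnegCoeff : Subsemiring ℝ⟦X⟧ where
  carrier := {f | ∀ n, 0 ≤ coeff n f}
  mul_mem' {f g} hf hg n := by
    rw [coeff_mul]
    exact Finset.sum_nonneg fun x _ => mul_nonneg (hf _) (hg _)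
  one_mem' n := by
    rw [coeff_one]
    split_ifs <;> norm_num
  add_mem' {f g} hf hg n := by
    rw [map_add]
    exact add_nonneg (hf n) (hg n)
  zero_mem' n := by simp

theorem mem_nonnegCoeff {f : ℝ⟦X⟧} : f ∈ nonnegCoeff ↔ ∀ n, 0 ≤ coeff n f := Iff.rfl

theorem smul_mem_nonnegCoeff {c : ℝ} (hc : 0 ≤ c) {f : ℝ⟦X⟧} (hf : f ∈ nonnegCoeff) :
    c • f ∈ nonnegCoeff := fun n => by
  rw [coeff_smul]
  exact mul_nonneg hc (hf n)

/-- The geometric series `1 + X + X ^ 2 + ⋯`; multiplying by it sums up coefficients. -/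
noncomputable def geometric : ℝ⟦X⟧ := mk fun _ => 1

theorem coeff_mul_geometric (f : ℝ⟦X⟧) (n : ℕ) :
    coeff n (f * geometric) = ∑ i ∈ Finset.range (n + 1), coeff i f := by
  rw [coeff_mul, Finset.Nat.sum_antidiagonal_eq_sum_range_succ_mk]
  simp [geometric]

end PowerSeries

/-! ### Matrices of bounded row mass and their limits. -/

namespace Matrix

variable {ι : Type*}

theorem tendsto_powerSeries_iff {β : Type*} {l : Filter β} {M : β → Matrix ι ι ℝ⟦X⟧}
    {N : Matrix ι ι ℝ⟦X⟧} :
    Tendsto M l (𝓝 N) ↔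
      ∀ i j n, Tendsto (fun b => coeff n (M b i j)) l (𝓝 (coeff n (N i j))) :=
  tendsto_pi_nhds.trans (forall_congr' fun _ => tendsto_pi_nhds.trans
    (forall_congr' fun _ => PowerSeries.WithPiTopology.tendsto_iff_coeff_tendsto ℝ _ _ _))

variable [Fintype ι]

/-- A matrix of power series with nonnegative coefficients such that, in each row, the sum of all
coefficients of all entries is at most `c`. -/
def RowMassLE (M : Matrix ι ι ℝ⟦X⟧) (c : ℝ) : Prop :=
  (∀ i j, M i j ∈ nonnegCoeff) ∧ ∀ i, c • geometric - ∑ j, M i j * geometric ∈ nonnegCoeff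

theorem rowMassLE_iff {M : Matrix ι ι ℝ⟦X⟧} {c : ℝ} :
    M.RowMassLE c ↔ (∀ i j n, 0 ≤ coeff n (M i j)) ∧
      ∀ i n, ∑ j, ∑ k ∈ Finset.range (n + 1), coeff k (M i j) ≤ c := by
  simp only [RowMassLE, mem_nonnegCoeff, map_sub, map_sum, coeff_smul, coeff_mul_geometric,
    sub_nonneg]
  simp [geometric]

/-- The slack of the product is `d` times the slack of `M` plus `M` times the slack of `N`; both are
coefficientwise nonnegative. -/
theorem RowMassLE.mul {M N : Matrix ι ι ℝ⟦X⟧} {c d : ℝ} (hM : M.RowMassLE c)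
    (hN : N.RowMassLE d) (hd : 0 ≤ d) : (M * N).RowMassLE (c * d) := by
  refine ⟨fun i j => ?_, fun i => ?_⟩
  · rw [mul_apply]
    exact sum_mem fun k _ => mul_mem (hM.1 _ _) (hN.1 _ _)
  · have h : (c * d) • geometric - ∑ k, (M * N) i k * geometric =
        d • (c • geometric - ∑ j, M i j * geometric) +
          ∑ j, M i j * (d • geometric - ∑ k, N j k * geometric) := by
      have h1 : ∑ k, (M * N) i k * geometric = ∑ j, M i j * ∑ k, N j k * geometric := by
        simp only [mul_apply, Finset.sum_mul, Finset.mul_sum, mul_assoc]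
        exact Finset.sum_comm
      have h2 : ∑ j, M i j * (d • geometric) = d • ∑ j, M i j * geometric := by
        simp only [mul_smul_comm, Finset.smul_sum]
      simp only [mul_sub, Finset.sum_sub_distrib]
      rw [h1, h2, smul_sub, smul_smul, mul_comm d c]
      abel
    rw [h]
    exact add_mem (smul_mem_nonnegCoeff hd (hM.2 i))
      (sum_mem fun j _ => mul_mem (hM.1 _ _) (hN.2 _))

theorem RowMassLE.mul_one_mass {M N : Matrix ι ι ℝ⟦X⟧} {c : ℝ} (hM : M.RowMassLE c)
    (hN : N.RowMassLE 1) : (M * N).RowMassLE c := by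
  simpa using hM.mul hN zero_le_one

theorem rowMassLE_one [DecidableEq ι] : (1 : Matrix ι ι ℝ⟦X⟧).RowMassLE 1 := by
  refine ⟨fun i j => ?_, fun i => ?_⟩
  · rw [one_apply]
    split_ifs
    exacts [one_mem _, zero_mem _]
  · simp [one_apply]

theorem RowMassLE.pow [DecidableEq ι] {M : Matrix ι ι ℝ⟦X⟧} (hM : M.RowMassLE 1) (n : ℕ) :
    (M ^ n).RowMassLE 1 := by
  induction n with
  | zero => simpa using rowMassLE_one
  | succ n ih => simpa [pow_succ] using ih.mul_one_mass hM

theorem RowMassLE.sum_range_le {M : Matrix ι ι ℝ⟦X⟧} {c : ℝ} (hM : M.RowMassLE c) (i j : ι)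
    (n : ℕ) : ∑ k ∈ Finset.range n, coeff k (M i j) ≤ c := by
  rw [rowMassLE_iff] at hM
  refine le_trans ?_ (hM.2 i n)
  refine (Finset.sum_le_sum_of_subset_of_nonneg (Finset.range_mono n.le_succ)
    fun k _ _ => hM.1 i j k).trans ?_
  exact Finset.single_le_sum (f := fun j => ∑ k ∈ Finset.range (n + 1), coeff k (M i j))
    (fun j _ => Finset.sum_nonneg fun k _ => hM.1 i j k) (Finset.mem_univ j)

theorem RowMassLE.coeff_le {M : Matrix ι ι ℝ⟦X⟧} {c : ℝ} (hM : M.RowMassLE c) (i j : ι)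
    (n : ℕ) : coeff n (M i j) ≤ c :=
  (Finset.single_le_sum (f := fun k => coeff k (M i j)) (fun k _ => hM.1 i j k)
    (Finset.self_mem_range_succ n)).trans (hM.sum_range_le i j (n + 1))

/-- Each coefficient lies in the compact interval `[0, c]`. The row bound survives because it is a
condition on finite partial sums only. -/
theorem exists_tendsto_of_rowMassLE {β : Type*} (l : Ultrafilter β) {M : β → Matrix ι ι ℝ⟦X⟧}
    {c : ℝ} (hM : ∀ b, (M b).RowMassLE c) :
    ∃ N : Matrix ι ι ℝ⟦X⟧, N.RowMassLE c ∧ Tendsto M l (𝓝 N) := by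
  have h : ∀ i j n, ∃ x, Tendsto (fun b => coeff n (M b i j)) l (𝓝 x) := fun i j n => by
    obtain ⟨x, -, hx⟩ := (isCompact_Icc (a := (0 : ℝ)) (b := c)).ultrafilter_le_nhds
      (l.map fun b => coeff n (M b i j))
      (le_principal_iff.2 (Filter.mem_map.2 (Filter.univ_mem' fun b =>
        ⟨(hM b).1 i j n, (hM b).coeff_le i j n⟩)))
    exact ⟨x, hx⟩
  choose x hx using h
  have hlim : ∀ i j n,
      Tendsto (fun b => coeff n (M b i j)) l (𝓝 (coeff n (PowerSeries.mk (x i j)))) := by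
    simpa using hx
  refine ⟨of fun i j => PowerSeries.mk (x i j), rowMassLE_iff.2 ⟨fun i j n => ?_, fun i n => ?_⟩,
    tendsto_powerSeries_iff.2 hlim⟩
  · exact ge_of_tendsto' (hlim i j n) fun b => (hM b).1 i j n
  · exact le_of_tendsto' (tendsto_finsetSum _ fun j _ => tendsto_finsetSum _ fun k _ => hlim i j k)
      fun b => (rowMassLE_iff.1 (hM b)).2 i n

/-! ### Loss of mass in the limit, and the almost nonnegative product. -/

/-- The coefficientwise positive part of `N - M`. -/
noncomputable def deficit (N M : Matrix ι ι ℝ⟦X⟧) : Matrix ι ι ℝ⟦X⟧ :=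
  of fun i j => PowerSeries.mk fun n => max (coeff n (N i j) - coeff n (M i j)) 0

/-- Mass is lost in the limit only by escaping to infinity, never gained. -/
theorem exists_deficit_rowMassLE {β : Type*} {l : Filter β} {M : β → Matrix ι ι ℝ⟦X⟧}
    {N : Matrix ι ι ℝ⟦X⟧} {c : ℝ} (hM : ∀ b, (M b).RowMassLE c) (hN : N.RowMassLE c)
    (h : Tendsto M l (𝓝 N)) :
    ∃ δ : β → ℝ, Tendsto δ l (𝓝 0) ∧ ∀ b, 0 ≤ δ b ∧ (deficit N (M b)).RowMassLE (δ b) := by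
  have hnn : ∀ b i j n, 0 ≤ coeff n (deficit N (M b) i j) := fun b i j n => by
    simp [deficit]
  have hle : ∀ b i j n, coeff n (deficit N (M b) i j) ≤ coeff n (N i j) := fun b i j n => by
    have := (hM b).1 i j n
    have := hN.1 i j n
    simp only [deficit, of_apply, coeff_mk]
    exact max_le (by linarith) (by linarith)
  have hsN : ∀ i j, Summable fun n => coeff n (N i j) := fun i j =>
    summable_of_sum_range_le (hN.1 i j) (hN.sum_range_le i j)
  have hs : ∀ b i j, Summable fun n => coeff n (deficit N (M b) i j) := fun b i j =>
    Summable.of_nonneg_of_le (hnn b i j) (hle b i j) (hsN i j)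
  -- The deficit is dominated by the summable coefficients of `N`, so dominated convergence sends
  -- its total mass to 0.
  refine ⟨fun b => ∑ i, ∑ j, ∑' n, coeff n (deficit N (M b) i j), ?_, fun b => ?_⟩
  · have key : ∀ i j, Tendsto (fun b => ∑' n, coeff n (deficit N (M b) i j)) l (𝓝 0) := by
      intro i j
      have := tendsto_tsum_of_dominated_convergence (𝓕 := l)
        (f := fun b n => coeff n (deficit N (M b) i j)) (g := fun _ => (0 : ℝ)) (hsN i j)
        (fun n => by
          have h1 := ((tendsto_powerSeries_iff.1 h i j n).const_sub (coeff n (N i j))).max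
            (tendsto_const_nhds (x := (0 : ℝ)))
          simpa [deficit] using h1)
        (Eventually.of_forall fun b n => by
          rw [Real.norm_of_nonneg (hnn b i j n)]
          exact hle b i j n)
      simpa using this
    simpa using tendsto_finsetSum Finset.univ fun i _ =>
      tendsto_finsetSum Finset.univ fun j _ => key i j
  · have hnn' : ∀ i, 0 ≤ ∑ j, ∑' n, coeff n (deficit N (M b) i j) := fun i =>
      Finset.sum_nonneg fun j _ => tsum_nonneg (hnn b i j)
    refine ⟨Finset.sum_nonneg fun i _ => hnn' i, rowMassLE_iff.2 ⟨hnn b, fun i n => ?_⟩⟩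
    refine le_trans ?_ (Finset.single_le_sum (fun i _ => hnn' i) (Finset.mem_univ i))
    exact Finset.sum_le_sum fun j _ => (hs b i j).sum_le_tsum _ fun n _ => hnn b i j n

/-- If `P` and `P'` almost dominate `F` and `F'`, then `(P - F) * (P' - F')` is almost
nonnegative. -/
theorem neg_le_coeff_mul_sub_mul_sub {L D P P' F F' : Matrix ι ι ℝ⟦X⟧} {δ δ' : ℝ}
    (hL : L.RowMassLE 1) (hD : D.RowMassLE 1) (hP : P.RowMassLE 1) (hP' : P'.RowMassLE 1)
    (hF : ∀ i j, F i j ∈ nonnegCoeff) (hF' : ∀ i j, F' i j ∈ nonnegCoeff)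
    (hδ₀ : 0 ≤ δ') (hδ : (deficit F P).RowMassLE δ) (hδ' : (deficit F' P').RowMassLE δ')
    (i o : ι) (m : ℕ) :
    -(δ + δ') ≤ coeff m ((L * (P - F) * (P' - F') * D) i o) := by
  have nonneg_mul : ∀ {M N : Matrix ι ι ℝ⟦X⟧}, (∀ i j, M i j ∈ nonnegCoeff) →
      (∀ i j, N i j ∈ nonnegCoeff) → ∀ i j, (M * N) i j ∈ nonnegCoeff := by
    intro M N hM hN i j
    rw [mul_apply]
    exact sum_mem fun k _ => mul_mem (hM _ _) (hN _ _)
  have nonneg_common : ∀ {M N : Matrix ι ι ℝ⟦X⟧}, (∀ i j, M i j ∈ nonnegCoeff) →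
      (∀ i j, N i j ∈ nonnegCoeff) → ∀ i j, (N - deficit N M) i j ∈ nonnegCoeff := by
    intro M N hM hN i j n
    have := hM i j n
    have := hN i j n
    simp only [deficit, sub_apply, of_apply, map_sub, coeff_mk]
    rcases max_cases (coeff n (N i j) - coeff n (M i j)) 0 with h | h <;> linarith
  have nonneg_surplus : ∀ {M N : Matrix ι ι ℝ⟦X⟧}, ∀ i j,
      (M - (N - deficit N M)) i j ∈ nonnegCoeff := by
    intro M N i j n
    simp only [deficit, sub_apply, of_apply, map_sub, coeff_mk]
    have := le_max_left (coeff n (N i j) - coeff n (M i j)) 0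
    linarith
  -- `F - deficit F P` is the coefficientwise minimum of `F` and `P`. Adding the two error terms on
  -- the left leaves only products of nonnegative factors on the right.
  have hid : L * (P - F) * (P' - F') * D + L * P * deficit F' P' * D +
        L * deficit F P * P' * D =
      L * (P - (F - deficit F P)) * (P' - (F' - deficit F' P')) * D +
        L * deficit F P * deficit F' P' * D +
        L * (F - deficit F P) * deficit F' P' * D +
        L * deficit F P * (F' - deficit F' P') * D := by
    noncomm_ring
  have h0 : 0 ≤ coeff m ((L * (P - F) * (P' - F') * D + L * P * deficit F' P' * D +
      L * deficit F P * P' * D) i o) := by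
    rw [hid]
    refine (add_mem (add_mem (add_mem ?_ ?_) ?_) ?_ :
      _ ∈ nonnegCoeff) m <;> refine nonneg_mul (nonneg_mul (nonneg_mul hL.1 ?_) ?_) hD.1 i o
    · exact nonneg_surplus
    · exact nonneg_surplus
    · exact hδ.1
    · exact hδ'.1
    · exact nonneg_common hP.1 hF
    · exact hδ'.1
    · exact hδ.1
    · exact nonneg_common hP'.1 hF'
  have h1 : coeff m ((L * P * deficit F' P' * D) i o) ≤ δ' := by
    simpa using (((hL.mul_one_mass hP).mul hδ' hδ₀).mul_one_mass hD).coeff_le i o m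
  have h2 : coeff m ((L * deficit F P * P' * D) i o) ≤ δ := by
    have hδ0 : 0 ≤ δ := ((hδ.1 i o) 0).trans (hδ.coeff_le i o 0)
    simpa using (((hL.mul hδ hδ0).mul_one_mass hP').mul_one_mass hD).coeff_le i o m
  simp only [add_apply, map_add] at h0
  linarith

/-- The values `coeff m (L m * A ^ n * B ^ k * D)` cannot exhibit, with a gap, the pattern
"`n ≠ k` and `m ∈ {n, k}`". -/
theorem not_separated [DecidableEq ι] {A B D : Matrix ι ι ℝ⟦X⟧} {L : ℕ → Matrix ι ι ℝ⟦X⟧}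
    (hA : A.RowMassLE 1) (hB : B.RowMassLE 1) (hD : D.RowMassLE 1) (hL : ∀ m, (L m).RowMassLE 1)
    (i o : ι) {α ε : ℝ} (hε : 0 < ε)
    (h₁ : ∀ m k, k ≠ m → α + ε ≤ coeff m ((L m * A ^ m * B ^ k * D) i o))
    (h₂ : ∀ m n, n ≠ m → α + ε ≤ coeff m ((L m * A ^ n * B ^ m * D) i o))
    (h₃ : ∀ m n k, n ≠ m → k ≠ m → k ≠ n → coeff m ((L m * A ^ n * B ^ k * D) i o) ≤ α - ε)
    (h₄ : ∀ m, coeff m ((L m * A ^ m * B ^ m * D) i o) ≤ α - ε) : False := by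
  obtain ⟨F, hF, hAF⟩ := exists_tendsto_of_rowMassLE (hyperfilter ℕ) hA.pow
  obtain ⟨E, hE, hBE⟩ := exists_tendsto_of_rowMassLE (hyperfilter ℕ) hB.pow
  have hne : ∀ m, ∀ᶠ n in (hyperfilter ℕ : Filter ℕ), n ≠ m := fun m =>
    hyperfilter_le_cofinite (Set.finite_singleton m).compl_mem_cofinite
  have limB : ∀ m n, Tendsto (fun k => coeff m ((L m * A ^ n * B ^ k * D) i o)) (hyperfilter ℕ)
      (𝓝 (coeff m ((L m * A ^ n * E * D) i o))) := fun m n =>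
    tendsto_powerSeries_iff.1 ((hBE.const_mul (L m * A ^ n)).mul_const D) i o m
  have limA : ∀ m (C : Matrix ι ι ℝ⟦X⟧), Tendsto (fun n => coeff m ((L m * A ^ n * C * D) i o)) (hyperfilter ℕ)
      (𝓝 (coeff m ((L m * F * C * D) i o))) := fun m C =>
    tendsto_powerSeries_iff.1 (((hAF.const_mul (L m)).mul_const C).mul_const D) i o m
  have h₁' : ∀ m, α + ε ≤ coeff m ((L m * A ^ m * E * D) i o) := fun m =>
    ge_of_tendsto (limB m m) ((hne m).mono fun k hk => h₁ m k hk)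
  have h₂' : ∀ m, α + ε ≤ coeff m ((L m * F * B ^ m * D) i o) := fun m =>
    ge_of_tendsto (limA m _) ((hne m).mono fun n hn => h₂ m n hn)
  -- Iterated limit, `k` before `n`: for fixed `m` and `n`, almost every `k` differs from both.
  have h₃' : ∀ m, coeff m ((L m * F * E * D) i o) ≤ α - ε := fun m =>
    le_of_tendsto (limA m _) ((hne m).mono fun n hn =>
      le_of_tendsto (limB m n) (((hne m).and (hne n)).mono fun k hk => h₃ m n k hn hk.1 hk.2))
  obtain ⟨δ, hδ, hδF⟩ := exists_deficit_rowMassLE hA.pow hF hAF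
  obtain ⟨δ', hδ', hδE⟩ := exists_deficit_rowMassLE hB.pow hE hBE
  -- The bounds force the coefficient of the product to be at most `(α - ε) - 2(α + ε) + (α - ε) =
  -- -4ε`.
  have hsmall : ∀ᶠ m in (hyperfilter ℕ : Filter ℕ), δ m + δ' m < 4 * ε := by
    have := hδ.add hδ'
    rw [add_zero] at this
    exact this.eventually_lt_const (by linarith)
  obtain ⟨m, hm⟩ := hsmall.exists
  have hlow := neg_le_coeff_mul_sub_mul_sub (hL m) hD (hA.pow m) (hB.pow m) hF.1 hE.1
    (hδE m).1 (hδF m).2 (hδE m).2 i o m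
  have hid : L m * (A ^ m - F) * (B ^ m - E) * D = L m * A ^ m * B ^ m * D -
      L m * A ^ m * E * D - L m * F * B ^ m * D + L m * F * E * D := by
    noncomm_ring
  rw [hid] at hlow
  simp only [add_apply, sub_apply, map_add, map_sub] at hlow
  linarith [h₁' m, h₂' m, h₃' m, h₄ m]

end Matrix

/-! ### Words as monomials. -/

open Classical in
/-- The monomial `X ^ n` for the word `b ^ n`, and zero for all words that contain other letters
than `b`. -/
noncomputable def wordSeries {B : Type*} (b : B) (w : List B) : ℝ⟦X⟧ :=
  if ∀ x ∈ w, x = b then X ^ w.length else 0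

theorem wordSeries_nil {B : Type*} (b : B) : wordSeries b [] = 1 := by
  simp [wordSeries]

theorem wordSeries_append {B : Type*} (b : B) (u v : List B) :
    wordSeries b (u ++ v) = wordSeries b u * wordSeries b v := by
  by_cases hu : ∀ x ∈ u, x = b
  · by_cases hv : ∀ x ∈ v, x = b
    · have huv : ∀ x ∈ u ++ v, x = b := fun x hx => (List.mem_append.1 hx).elim (hu x) (hv x)
      rw [wordSeries, wordSeries, wordSeries, if_pos hu, if_pos hv, if_pos huv,
        List.length_append, pow_add]
    · have huv : ¬ ∀ x ∈ u ++ v, x = b := fun h => hv fun x hx => h x (List.mem_append_right u hx)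
      rw [wordSeries, wordSeries, wordSeries, if_neg hv, if_neg huv, mul_zero]
  · have huv : ¬ ∀ x ∈ u ++ v, x = b := fun h => hu fun x hx => h x (List.mem_append_left v hx)
    rw [wordSeries, wordSeries, wordSeries, if_neg hu, if_neg huv, zero_mul]

theorem coeff_wordSeries {B : Type*} [DecidableEq B] (b : B) (w : List B) (n : ℕ) :
    coeff n (wordSeries b w) = if w = List.replicate n b then 1 else 0 := by
  simp only [wordSeries, List.eq_replicate_iff]
  by_cases hw : ∀ x ∈ w, x = b
  · rw [if_pos hw, coeff_X_pow]
    exact if_congr ⟨fun h => ⟨h.symm, hw⟩, fun h => h.1.symm⟩ rfl rfl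
  · rw [if_neg hw, if_neg fun h => hw h.2, map_zero]

theorem wordSeries_mem_nonnegCoeff {B : Type*} (b : B) (w : List B) :
    wordSeries b w ∈ nonnegCoeff := fun n => by
  classical
  rw [coeff_wordSeries]
  split_ifs <;> norm_num

theorem sum_range_coeff_wordSeries_le {B : Type*} (b : B) (w : List B) (n : ℕ) :
    ∑ k ∈ Finset.range n, coeff k (wordSeries b w) ≤ 1 := by
  classical
  rw [wordSeries]
  split_ifs
  · simp only [coeff_X_pow, Finset.sum_ite_eq']
    split_ifs <;> norm_num
  · simp

/-- The running and the accepted weights (the latter at `none`) of outputs `b ^ n`, collected into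
power series. -/
noncomputable def TotalState.series {Q B : Type*} [DecidableEq Q] (b : B) (S : TotalState Q B) :
    Option Q → ℝ⟦X⟧
  | some q => Finsupp.linearCombination ℝ
      (fun x : Q × List B => if x.1 = q then wordSeries b x.2 else 0) S.running
  | none => Finsupp.linearCombination ℝ (wordSeries b) S.accepted

/-! ### Transducer runs as matrix products. -/

namespace PFST

variable {Q A B : Type*} [Fintype Q] [DecidableEq Q] [Fintype A] [Fintype B]

/-- The action of a tape symbol on the series of a total state; `none` stands for acceptance. -/
noncomputable def seriesMatrix (T : PFST Q A B) (b : B) (a : TapeSymbol A) :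
    Matrix (Option Q) (Option Q) ℝ⟦X⟧
  | some q, some p => if p ∈ T.non then T.V a q p • wordSeries b (T.f a q) else 0
  | some q, none => (∑ p ∈ T.acc, T.V a q p) • wordSeries b (T.f a q)
  | none, some _ => 0
  | none, none => 1

theorem V_nonneg (T : PFST Q A B) (a : TapeSymbol A) (q p : Q) : 0 ≤ T.V a q p :=
  (Matrix.mem_rowStochastic_iff_sum.1 (T.stochastic a)).1 q p

theorem sum_V (T : PFST Q A B) (a : TapeSymbol A) (q : Q) : ∑ p, T.V a q p = 1 :=
  (Matrix.mem_rowStochastic_iff_sum.1 (T.stochastic a)).2 q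

theorem seriesMatrix_rowMassLE (T : PFST Q A B) (b : B) (a : TapeSymbol A) :
    (T.seriesMatrix b a).RowMassLE 1 := by
  have hw := wordSeries_mem_nonnegCoeff b
  refine Matrix.rowMassLE_iff.2 ⟨fun o o' => ?_, fun o n => ?_⟩
  · refine mem_nonnegCoeff.1 ?_
    rcases o with _ | q <;> rcases o' with _ | p <;> simp only [seriesMatrix]
    · exact one_mem _
    · exact zero_mem _
    · exact smul_mem_nonnegCoeff (Finset.sum_nonneg fun p _ => T.V_nonneg a q p) (hw _)
    · split_ifs
      · exact smul_mem_nonnegCoeff (T.V_nonneg a q p) (hw _)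
      · exact zero_mem _
  · rcases o with _ | q
    · simp [Fintype.sum_option, seriesMatrix, coeff_one]
    -- The printed word depends only on the source state, so its mass `s` factors out of the row;
    -- the weight of rejection is dropped.
    · set s := ∑ k ∈ Finset.range (n + 1), coeff k (wordSeries b (T.f a q)) with hs
      have hs1 : s ≤ 1 := sum_range_coeff_wordSeries_le _ _ _
      have hdisj : Disjoint T.acc T.non :=
        (disjoint_compl_right (a := T.acc ∪ T.rej)).mono_left Finset.subset_union_left
      have hV : ∑ p ∈ T.acc, T.V a q p + ∑ p ∈ T.non, T.V a q p ≤ 1 := by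
        rw [← Finset.sum_union hdisj, ← T.sum_V a q]
        exact Finset.sum_le_sum_of_subset_of_nonneg (Finset.subset_univ _)
          fun p _ _ => T.V_nonneg a q p
      have hV0 : 0 ≤ ∑ p ∈ T.acc, T.V a q p + ∑ p ∈ T.non, T.V a q p :=
        add_nonneg (Finset.sum_nonneg fun p _ => T.V_nonneg a q p)
          (Finset.sum_nonneg fun p _ => T.V_nonneg a q p)
      have hacc : ∑ k ∈ Finset.range (n + 1), coeff k (T.seriesMatrix b a (some q) none) =
          (∑ p ∈ T.acc, T.V a q p) * s := by
        simp only [seriesMatrix, coeff_smul, ← Finset.mul_sum, smul_eq_mul, hs]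
      have hnon : ∑ p, ∑ k ∈ Finset.range (n + 1),
          coeff k (T.seriesMatrix b a (some q) (some p)) = (∑ p ∈ T.non, T.V a q p) * s := by
        rw [Finset.sum_mul, ← Finset.univ_inter T.non, ← Finset.filter_mem_eq_inter, Finset.sum_filter]
        refine Finset.sum_congr rfl fun p _ => ?_
        simp only [seriesMatrix]
        split_ifs
        · simp only [coeff_smul, ← Finset.mul_sum, smul_eq_mul, hs]
        · simp
      rw [Fintype.sum_option, hacc, hnon, ← add_mul]
      exact (mul_le_of_le_one_right hV0 hs1).trans hV

/-- Words containing another letter may be sent to 0 because they never become powers of `b` again;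
this makes `wordSeries` multiplicative and the step linear. -/
theorem series_step (T : PFST Q A B) (b : B) (a : TapeSymbol A) (S : TotalState Q B) :
    (T.step a S).series b = S.series b ᵥ* T.seriesMatrix b a := by
  funext o
  rw [Matrix.vecMul, dotProduct, Fintype.sum_option]
  rcases o with _ | p
  · simp only [TotalState.series, step, seriesMatrix, map_add, mul_one, map_finsuppSum,
      Finsupp.linearCombination_single, wordSeries_append]
    congr 1
    simp only [Finsupp.linearCombination_apply, Finsupp.sum, Finset.sum_mul]
    rw [Finset.sum_comm]
    refine Finset.sum_congr rfl fun x _ => ?_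
    simp [smul_smul, mul_comm]
  · simp only [TotalState.series, step, seriesMatrix, mul_zero, zero_add, map_finsuppSum, map_sum,
      Finsupp.linearCombination_single, wordSeries_append]
    simp only [Finsupp.linearCombination_apply, Finsupp.sum, Finset.sum_mul]
    refine Eq.trans (Finset.sum_congr rfl fun x _ => ?_) Finset.sum_comm
    simp [smul_smul, mul_comm]

theorem series_foldl_step (T : PFST Q A B) (b : B) (l : List (TapeSymbol A))
    (S : TotalState Q B) :
    (l.foldl (fun S a => T.step a S) S).series b =
      S.series b ᵥ* (l.map (T.seriesMatrix b)).prod := by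
  induction l generalizing S with
  | nil => simp
  | cons a l ih => simp [ih, series_step]

theorem series_initial (T : PFST Q A B) (b : B) :
    T.initial.series b = Pi.single (some T.q₀) 1 := by
  funext o
  rcases o with _ | q
  · simp [TotalState.series, initial]
  · simp [TotalState.series, initial, wordSeries_nil, Pi.single_apply, eq_comm]

theorem prob_replicate (T : PFST Q A B) (b : B) (m : ℕ) (v : List A) :
    T.prob (List.replicate m b) v = coeff m ((T.seriesMatrix b TapeSymbol.start *
      (v.map fun a => T.seriesMatrix b (TapeSymbol.letter a)).prod *
        T.seriesMatrix b TapeSymbol.finish) (some T.q₀) none) := by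
  classical
  have h : ∀ S : TotalState Q B, coeff m (S.series b none) = S.accepted (List.replicate m b) := by
    intro S
    simp [TotalState.series, Finsupp.linearCombination_apply, Finsupp.sum, coeff_wordSeries]
    exact Eq.symm
  rw [prob, ← h, run, series_foldl_step, series_initial, Matrix.single_one_vecMul]
  simp [mul_assoc, Function.comp_def]

end PFST

theorem mem_relationR3_iff {A B : Type*} {a₀ a₁ a₂ : A} (h₀₁ : a₀ ≠ a₁) (h₀₂ : a₀ ≠ a₂)
    (h₁₂ : a₁ ≠ a₂) (b₃ : B) (m n k : ℕ) :
    (List.replicate m a₀ ++ List.replicate n a₁ ++ List.replicate k a₂, List.replicate m b₃) ∈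
      relationR3 a₀ a₁ a₂ b₃ ↔ n ≠ k ∧ (m = k ∨ m = n) := by
  classical
  refine ⟨?_, fun h => ⟨m, n, k, h.1, h.2, rfl⟩⟩
  rintro ⟨m', n', k', hnk, hm, heq⟩
  have hv := (Prod.ext_iff.1 heq).1
  -- As the letters are distinct, counting each one recovers the exponents.
  have h0 := congrArg (List.count a₀) hv
  have h1 := congrArg (List.count a₁) hv
  have h2 := congrArg (List.count a₂) hv
  simp [List.count_replicate, h₀₁, h₀₂, h₁₂, h₀₁.symm, h₀₂.symm, h₁₂.symm] at h0 h1 h2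
  subst h0 h1 h2
  exact ⟨hnk, hm⟩

/-! ### Impossibility for transducers. -/

namespace PFST

variable {Q A B : Type*} [Fintype Q] [DecidableEq Q] [Fintype A] [Fintype B]

theorem not_computesWithIsolatedCutpoint_relationR3 (T : PFST Q A B) {a₀ a₁ a₂ : A}
    (h₀₁ : a₀ ≠ a₁) (h₀₂ : a₀ ≠ a₂) (h₁₂ : a₁ ≠ a₂) (b₃ : B) (α : ℝ) :
    ¬ T.ComputesWithIsolatedCutpoint (relationR3 a₀ a₁ a₂ b₃) α := by
  rintro ⟨-, -, ε, hε, h⟩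
  have hM := T.seriesMatrix_rowMassLE b₃
  have hp : ∀ m n k, T.prob (List.replicate m b₃)
      (List.replicate m a₀ ++ List.replicate n a₁ ++ List.replicate k a₂) =
      coeff m ((T.seriesMatrix b₃ TapeSymbol.start *
        T.seriesMatrix b₃ (TapeSymbol.letter a₀) ^ m *
        T.seriesMatrix b₃ (TapeSymbol.letter a₁) ^ n *
        T.seriesMatrix b₃ (TapeSymbol.letter a₂) ^ k *
        T.seriesMatrix b₃ TapeSymbol.finish) (some T.q₀) none) := fun m n k => by
    simp [prob_replicate, mul_assoc]
  have hR := mem_relationR3_iff h₀₁ h₀₂ h₁₂ b₃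
  have hhigh : ∀ m n k, n ≠ k ∧ (m = k ∨ m = n) → α + ε ≤ _ := fun m n k hmnk =>
    ((h _ _).1 ((hR m n k).2 hmnk)).trans_eq (hp m n k)
  have hlow : ∀ m n k, ¬ (n ≠ k ∧ (m = k ∨ m = n)) → _ ≤ α - ε := fun m n k hmnk =>
    (hp m n k).symm.trans_le ((h _ _).2 (mt (hR m n k).1 hmnk))
  refine Matrix.not_separated (hM (TapeSymbol.letter a₁)) (hM (TapeSymbol.letter a₂))
    (hM TapeSymbol.finish)
    (fun m => (hM TapeSymbol.start).mul_one_mass ((hM (TapeSymbol.letter a₀)).pow m))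
    (some T.q₀) none hε (fun m k hk => hhigh m m k ⟨hk.symm, Or.inr rfl⟩)
    (fun m n hn => hhigh m n m ⟨hn, Or.inl rfl⟩)
    (fun m n k hn hk _ => hlow m n k fun h => h.2.elim hk.symm hn.symm)
    (fun m => hlow m m m fun h => h.1 rfl)

theorem ComputesWithProbability.computesWithIsolatedCutpoint {T : PFST Q A B}
    {R : Set (List A × List B)} {α : ℝ} (h : T.ComputesWithProbability R α) :
    T.ComputesWithIsolatedCutpoint R (1 / 2) := by
  -- The bounds `α` and `1 - α` lie at distance `α - 1/2` from the cutpoint `1/2`.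
  refine ⟨by norm_num, by norm_num, α - 1 / 2, sub_pos.2 h.1, fun v w => ⟨fun hvw => ?_,
    fun hvw => ?_⟩⟩
  · linarith [(h.2 v w).1 hvw]
  · linarith [(h.2 v w).2 hvw]

end PFST

theorem mainTheorem3 {Q A B : Type*} [Fintype Q] [DecidableEq Q] [Fintype A] [Fintype B]
    (a₀ a₁ a₂ : A) (h₀₁ : a₀ ≠ a₁) (h₀₂ : a₀ ≠ a₂) (h₁₂ : a₁ ≠ a₂) (b₃ : B)
    (T : PFST Q A B) :
    (¬ ∃ α : ℝ, T.ComputesWithProbability (relationR3 a₀ a₁ a₂ b₃) α) ∧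
      ¬ ∃ α : ℝ, T.ComputesWithIsolatedCutpoint (relationR3 a₀ a₁ a₂ b₃) α := by
  have h := T.not_computesWithIsolatedCutpoint_relationR3 h₀₁ h₀₂ h₁₂ b₃
  exact ⟨fun ⟨_, hα⟩ => h _ hα.computesWithIsolatedCutpoint, fun ⟨α, hα⟩ => h α hα⟩
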